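/- Let $\psi:\mathbb R\to\mathbb R$ be a nonnegative Schwartz function whose Fourier transform $\hat\psi(\omega)=\int_{\mathbb R}\psi(t)e^{-i\omega t}\,dt$ is supported in $[-1,1]$, and let $c>0$. There is a constant $C>0$, depending only on $\psi$ and $c$, such that the following holds. Let $\mu\in C^\infty(\mathbb R^3)$ be supported in $\{\xi\in\mathbb R^3: \tfrac12\le\|\xi\|\le 2\}$ with $\sum_{k\in\mathbb Z}\mu(2^{-k}\xi)=1$ for all $\xi\ne 0$. For $F\in L^2(\mathbb R^3)$ and $k\in\mathbb Z$ define $S_kF\in L^2(\mathbb R^3)$ by $\widehat{S_kF}(\xi)=\mu(2^{-k}\xi)\,\hat F(\xi)$, where $\hat F$ is the Fourier transform with kernel $e^{-ix\cdot\xi}$. Let $\Sigma\subset S^2$ be a set of $N$ unit vectors in $\mathbb R^3$ such that $$\|v-v'\|\ge c\,N^{-1/2}\qquad\text{for all } v\ne v'\in\Sigma .$$ For $G\in L^2(\mathbb R^3)$ put $$M_0G(x)=\max_{v\in\Sigma}\Big|\int_{\mathbb R}G(x+tv)\,\psi(t)\,dt\Big| .$$ Then for every integer $k\ge 0$ and every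 (complex-valued) $F\in L^2(\mathbb R^3)$, the integrals defining $M_0(S_kF)(x)$ converge absolutely for almost every $x$, $M_0(S_kF)\in L^2(\mathbb R^3)$, and $$\|M_0(S_kF)\|_{L^2(\mathbb R^3)}\le C\,N^{1/4}\,\|S_kF\|_{L^2(\mathbb R^3)} .$$ -/

import Mathlib

open MeasureTheory
open scoped FourierTransform ENNReal NNReal ContDiff

noncomputable section

/-- Three-dimensional Euclidean space. -/
abbrev R3 : Type := EuclideanSpace ℝ (Fin 3)

/-- The dyadic annulus `{ξ : 2^(k-1) ≤ ‖ξ‖ ≤ 2^(k+1)}`. -/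
def dyadicAnnulus (k : ℤ) : Set R3 :=
  {ξ | (2 : ℝ) ^ (k - 1) ≤ ‖ξ‖ ∧ ‖ξ‖ ≤ (2 : ℝ) ^ (k + 1)}

/-- The Fourier transform on the line in the angular-frequency convention,
`s ↦ ∫ ψ(t) e^{-ist} dt`. -/
def angularFourier (ψ : ℝ → ℝ) (s : ℝ) : ℂ :=
  ∫ t : ℝ, Complex.exp (-Complex.I * s * t) * (ψ t : ℂ)

/-- A smooth function `μ` supported in the annulus `{1/2 ≤ ‖ξ‖ ≤ 2}` whose dyadic dilates
`μ(2^{-k} ·)`, `k ∈ ℤ`, sum to one away from the origin. -/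
structure DyadicCutoff where
  toFun : R3 → ℂ
  smooth : ContDiff ℝ ∞ toFun
  support_subset : Function.support toFun ⊆ dyadicAnnulus 0
  partition : ∀ ξ : R3, ξ ≠ 0 → HasSum (fun k : ℤ => toFun ((2 : ℝ) ^ (-k) • ξ)) 1

/-- The dilate `μ_k(ξ) = μ(2^{-k} ξ)`. -/
def DyadicCutoff.dilate (μ : DyadicCutoff) (k : ℤ) (ξ : R3) : ℂ :=
  μ.toFun ((2 : ℝ) ^ (-k) • ξ)

/-- The product of `μ_k` with an `L²` function of the variable `ζ = ξ / (2π)` is in `L²`. -/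
theorem DyadicCutoff.memLp_dilate_mul (μ : DyadicCutoff) (k : ℤ)
    (G : Lp ℂ 2 (volume : Measure R3)) :
    MemLp (fun ζ : R3 => μ.dilate k ((2 * Real.pi) • ζ) * G ζ) 2 volume := by
  have hc : Continuous μ.toFun := μ.smooth.continuous
  have hcs : HasCompactSupport μ.toFun := by
    refine HasCompactSupport.intro (isCompact_closedBall (0 : R3) 2) fun x hx => ?_
    by_contra h
    apply hx
    have h2 := (μ.support_subset (Function.mem_support.mpr h)).2
    simpa using h2
  obtain ⟨C, hC⟩ := hcs.exists_bound_of_continuous hc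
  refine MemLp.of_le_mul (c := C) (Lp.memLp G) ?_ (Filter.Eventually.of_forall fun ζ => ?_)
  · refine AEStronglyMeasurable.mul ?_ (Lp.aestronglyMeasurable G)
    refine Continuous.aestronglyMeasurable ?_
    unfold DyadicCutoff.dilate
    fun_prop
  · rw [norm_mul]
    exact mul_le_mul_of_nonneg_right (hC _) (norm_nonneg _)

/-- The frequency localization `S_k` on `L²(ℝ³)`: the Fourier multiplier with symbol `μ_k(ξ)`
in the angular-frequency variable `ξ`. Mathlib's Fourier transform `𝓕` uses the kernel
`e^{-2πi x·ζ}`, so that `ξ = 2π ζ`. -/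
def freqLocalize (μ : DyadicCutoff) (k : ℤ) (F : Lp ℂ 2 (volume : Measure R3)) :
    Lp ℂ 2 (volume : Measure R3) :=
  𝓕⁻ ((μ.memLp_dilate_mul k (𝓕 F)).toLp _)

/-- The smoothed average `T_v G(x) = ∫ G(x + t v) ψ(t) dt`. -/
def directionalAverage (ψ : ℝ → ℝ) (v : R3) (G : R3 → ℂ) (x : R3) : ℂ :=
  ∫ t : ℝ, G (x + t • v) * (ψ t : ℂ)

/-- The maximal function `M₀ G(x) = max_{v ∈ S} |T_v G(x)|` over a finite set `S` of directions
(zero if `S` is empty). -/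
def directionalMax (ψ : ℝ → ℝ) (S : Finset R3) (G : R3 → ℂ) (x : R3) : ℝ :=
  ((S.sup fun v => ‖directionalAverage ψ v G x‖₊ : ℝ≥0) : ℝ)

end

/-! With `δ = 2^(-k)`, `S_k F` is the inverse Fourier integral of a function `h` living where `‖ζ‖`
is comparable to `δ⁻¹`, so `h` is in `L¹ ∩ L²`. Averaging in direction `v` multiplies `h` by `m₀(ζ ·
v)`, where `m₀` is supported in `|s| ≤ 1/(2π)` (`directionalAverage_fourierInv`). Hence `v` only
sees frequencies in the slab `|ζ · v| ≤ 2δ‖ζ‖`, and the theorem becomes a count of directions close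
to the great circle orthogonal to a given `ζ`.

Put `ρ = N^(-1/2)`. In both of the following cases the square of the maximal function has a majorant
with integral at most a constant times `ρ⁻¹ ‖h‖₂²`, and `ρ⁻¹ = N^(1/2)`; a square root gives
`N^(1/4)`.

If `δ ≤ ρ`, the majorant is the sum of squares over the directions (`exists_majorant_separated`). By
Plancherel its cost is the largest number of slabs through one `ζ`. Disjoint balls of radius `cρ/2`
packed into a band of volume about `ρ²` show that this is `O(ρ⁻¹)` (`card_filter_slab_le`).

If `ρ ≤ δ`, separation is irrelevant and the supremum is taken over the whole sphere
(`exists_majorant_sphere`). The averages vary in `v` at scale `δ`, so a Sobolev inequality bounds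
each by `δ⁻³` times an integral over a shell of thickness about `δ`. For fixed `ζ` the part of the
shell in the slab has volume `O(δ²)` by `volume_equatorialBand_le`, so the cost is `O(δ⁻¹)`, hence
`O(ρ⁻¹)`. -/

/-! ### The inverse Fourier integral on `L¹ ∩ L²`. -/

section FourierInverse

variable {E : Type*} [NormedAddCommGroup E] [InnerProductSpace ℝ E] [FiniteDimensional ℝ E]
  [MeasurableSpace E] [BorelSpace E]

/-- The inverse Fourier integral is self-adjoint for the bilinear pairing of integrable
functions. -/
theorem integral_fourierInv_mul_eq {f g : E → ℂ} (hf : Integrable f) (hg : Integrable g) :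
    ∫ ξ, 𝓕⁻ f ξ * g ξ = ∫ x, f x * 𝓕⁻ g x := by
  have h := VectorFourier.integral_fourierIntegral_smul_eq_flip (e := Real.fourierChar)
    (μ := (volume : Measure E)) (ν := (volume : Measure E)) (L := -innerₗ E) (f := f) (g := g)
    Real.continuous_fourierChar
    (show Continuous fun p : E × E => -inner ℝ p.1 p.2 from continuous_inner.neg) hf hg
  have hflip : (-innerₗ E).flip = -innerₗ E := by
    ext x y
    simp [real_inner_comm]
  rw [hflip] at h
  exact h

theorem continuous_fourierInv {f : E → ℂ} (hf : Integrable f) : Continuous (𝓕⁻ f) := by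
  refine VectorFourier.fourierIntegral_continuous (L := -innerₗ E) Real.continuous_fourierChar
    (show Continuous fun p : E × E => -inner ℝ p.1 p.2 from continuous_inner.neg) hf

/-- On `L¹ ∩ L²` the `L²` inverse Fourier transform is given by the inverse Fourier integral. -/
theorem fourierInv_toLp_ae_eq {f : E → ℂ} (hf : Integrable f) (hf2 : MemLp f 2 volume) :
    (𝓕⁻ (hf2.toLp f) : Lp ℂ 2 (volume : Measure E)) =ᵐ[volume] 𝓕⁻ f := by
  -- Both sides are locally integrable, so it suffices to test against smooth compactly supported
  -- `g`. The transform is moved onto `g`, where the `L²` and integral definitions agree, and back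
  -- by self-adjointness.
  refine ae_eq_of_integral_contDiff_smul_eq
    ((Lp.memLp (𝓕⁻ (hf2.toLp f))).locallyIntegrable one_le_two)
    (continuous_fourierInv hf).locallyIntegrable fun g hg hgs => ?_
  have hg1 : ContDiff ℝ ∞ (fun x => (g x : ℂ)) := Complex.ofRealCLM.contDiff.comp hg
  have hg2 : HasCompactSupport (fun x => (g x : ℂ)) := hgs.comp_left Complex.ofReal_zero
  set φ := hg2.toSchwartzMap hg1 with hφ
  have hφg : ∀ x, φ x = (g x : ℂ) := fun x => rfl
  have key := DFunLike.congr_fun (Lp.fourierInv_toTemperedDistribution_eq (hf2.toLp f)) φ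
  rw [TemperedDistribution.fourierInv_apply, Lp.toTemperedDistribution_apply,
    Lp.toTemperedDistribution_apply] at key
  calc ∫ x, g x • (𝓕⁻ (hf2.toLp f) : Lp ℂ 2 (volume : Measure E)) x
      = ∫ x, φ x • (𝓕⁻ (hf2.toLp f) : Lp ℂ 2 (volume : Measure E)) x := by
        simp [hφg]
    _ = ∫ x, (𝓕⁻ φ) x • (hf2.toLp f) x := key.symm
    _ = ∫ x, 𝓕⁻ (φ : E → ℂ) x * f x := by
        refine integral_congr_ae ?_
        filter_upwards [hf2.coeFn_toLp] with x hx
        rw [hx, SchwartzMap.fourierInv_coe, smul_eq_mul]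
    _ = ∫ x, φ x * 𝓕⁻ f x := integral_fourierInv_mul_eq φ.integrable hf
    _ = ∫ x, g x • 𝓕⁻ f x := by simp [hφg]

/-- The inverse Fourier transform preserves the `L²` seminorm. -/
theorem eLpNorm_fourierInv_toLp {f : E → ℂ} (hf2 : MemLp f 2 volume) :
    eLpNorm (𝓕⁻ (hf2.toLp f) : Lp ℂ 2 (volume : Measure E)) 2 volume = eLpNorm f 2 volume := by
  have h : ‖(𝓕⁻ (hf2.toLp f) : Lp ℂ 2 (volume : Measure E))‖ = ‖hf2.toLp f‖ :=
    (Lp.fourierTransformₗᵢ E ℂ).symm.norm_map _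
  rw [← Lp.enorm_def, ← eLpNorm_congr_ae hf2.coeFn_toLp, ← Lp.enorm_def, ← ofReal_norm, h,
    ofReal_norm]

/-- Plancherel's identity for the inverse Fourier integral on `L¹ ∩ L²`. -/
theorem lintegral_enorm_fourierInv_sq {f : E → ℂ} (hf : Integrable f) (hf2 : MemLp f 2 volume) :
    ∫⁻ x, ‖𝓕⁻ f x‖ₑ ^ 2 = ∫⁻ ξ, ‖f ξ‖ₑ ^ 2 := by
  have h := eLpNorm_fourierInv_toLp hf2
  rw [eLpNorm_congr_ae (fourierInv_toLp_ae_eq hf hf2)] at h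
  have e2 : ∀ u : E → ℂ, eLpNorm u 2 volume ^ 2 = ∫⁻ x, ‖u x‖ₑ ^ 2 := fun u => by
    simpa using eLpNorm_nnreal_pow_eq_lintegral (f := u) (μ := volume) (p := 2) two_ne_zero
  rw [← e2, ← e2, h]

end FourierInverse

/-! ### Volumes of equatorial bands. -/

/-- The point of `ℝ³` with the given coordinates. -/
def ofCoords (p : ℝ × ℝ × ℝ) : R3 := !₂[p.1, p.2.1, p.2.2]

theorem measurePreserving_ofCoords : MeasurePreserving ofCoords volume volume := by
  have h1 := (volume_preserving_piFinSuccAbove (fun _ : Fin 3 => ℝ) 0).symm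
  have h2 : MeasurePreserving (Prod.map id (MeasurableEquiv.finTwoArrow (α := ℝ)).symm)
      (volume : Measure (ℝ × ℝ × ℝ)) (volume : Measure (ℝ × (Fin 2 → ℝ))) :=
    (MeasurePreserving.id volume).prod (volume_preserving_finTwoArrow ℝ).symm
  have h3 := ((PiLp.volume_preserving_toLp (Fin 3)).comp h1).comp h2
  have h4 : ofCoords = (WithLp.toLp 2 ∘ (MeasurableEquiv.piFinSuccAbove (fun _ => ℝ) 0).symm) ∘
      Prod.map id MeasurableEquiv.finTwoArrow.symm := by
    funext p
    refine PiLp.ext fun i => ?_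
    fin_cases i <;> rfl
  rw [h4]
  exact h3

theorem norm_ofCoords_sq (p : ℝ × ℝ × ℝ) :
    ‖ofCoords p‖ ^ 2 = p.1 ^ 2 + p.2.1 ^ 2 + p.2.2 ^ 2 := by
  simp [ofCoords, EuclideanSpace.norm_sq_eq, Fin.sum_univ_three]

theorem inner_ofCoords (ζ : R3) (p : ℝ × ℝ × ℝ) :
    inner ℝ ζ (ofCoords p) = ζ 0 * p.1 + ζ 1 * p.2.1 + ζ 2 * p.2.2 := by
  simp [ofCoords, PiLp.inner_apply, Fin.sum_univ_three, mul_comm]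

theorem ofCoords_coords (u : R3) : ofCoords (u 0, u 1, u 2) = u := by
  ext i
  fin_cases i <;> rfl

/-- The area of a planar annulus, in terms of the squared radius. -/
theorem volume_annulus_le (A B : ℝ) :
    volume {y : ℝ × ℝ | A ≤ y.1 ^ 2 + y.2 ^ 2 ∧ y.1 ^ 2 + y.2 ^ 2 ≤ B} ≤
      ENNReal.ofReal (Real.pi * (B - A)) := by
  set s := {y : ℝ × ℝ | A ≤ y.1 ^ 2 + y.2 ^ 2 ∧ y.1 ^ 2 + y.2 ^ 2 ≤ B} with hs
  rcases lt_or_ge B 0 with hB | hB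
  · have : s = ∅ := by
      ext y
      simp only [hs, Set.mem_ofPred_eq, Set.mem_empty_iff_false, iff_false, not_and, not_le]
      intro _
      nlinarith [sq_nonneg y.1, sq_nonneg y.2]
    simp [this]
  rcases lt_or_ge B A with hAB | hAB
  · have : s = ∅ := by
      ext y
      simp only [hs, Set.mem_ofPred_eq, Set.mem_empty_iff_false, iff_false, not_and, not_le]
      intro h
      linarith
    simp [this]
  have hms : MeasurableSet s := by
    have h1 : MeasurableSet {y : ℝ × ℝ | A ≤ y.1 ^ 2 + y.2 ^ 2} :=
      measurableSet_le (by fun_prop) (by fun_prop)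
    have h2 : MeasurableSet {y : ℝ × ℝ | y.1 ^ 2 + y.2 ^ 2 ≤ B} :=
      measurableSet_le (by fun_prop) (by fun_prop)
    exact h1.inter h2
  rw [← Complex.volume_preserving_equiv_real_prod.measure_preimage hms.nullMeasurableSet]
  have hsub : Complex.measurableEquivRealProd ⁻¹' s ⊆
      -- The truncation at `0` covers slices that are full discs, where `A` is negative.
      Metric.closedBall (0 : ℂ) (√B) \ Metric.ball 0 (√(max A 0)) := by
    intro z hz
    have hz' : A ≤ z.re ^ 2 + z.im ^ 2 ∧ z.re ^ 2 + z.im ^ 2 ≤ B := hz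
    have hn : ‖z‖ ^ 2 = z.re ^ 2 + z.im ^ 2 := by
      rw [← Complex.normSq_eq_norm_sq, Complex.normSq_apply]; ring
    rw [← hn] at hz'
    constructor
    · rw [mem_closedBall_zero_iff]
      exact Real.le_sqrt_of_sq_le hz'.2
    · rw [mem_ball_zero_iff, not_lt]
      exact Real.sqrt_le_iff.2 ⟨norm_nonneg _, max_le hz'.1 (sq_nonneg _)⟩
  have hle : max A 0 ≤ B := max_le hAB hB
  refine (measure_mono hsub).trans ?_
  rw [measure_sdiff ((Metric.ball_subset_closedBall).trans
    (Metric.closedBall_subset_closedBall (Real.sqrt_le_sqrt hle)))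
    measurableSet_ball.nullMeasurableSet measure_ball_lt_top.ne,
    Complex.volume_closedBall, Complex.volume_ball, ← ENNReal.ofReal_pow (Real.sqrt_nonneg _),
    ← ENNReal.ofReal_pow (Real.sqrt_nonneg _), Real.sq_sqrt hB, Real.sq_sqrt (le_max_right _ _)]
  have hpi : (NNReal.pi : ℝ≥0∞) = ENNReal.ofReal Real.pi := by
    rw [← NNReal.coe_real_pi, ENNReal.ofReal_coe_nnreal]
  rw [hpi, ← ENNReal.ofReal_mul hB, ← ENNReal.ofReal_mul (le_max_right _ _),
    ← ENNReal.ofReal_sub _ (mul_nonneg (le_max_right _ _) Real.pi_pos.le)]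
  refine ENNReal.ofReal_le_ofReal ?_
  nlinarith [Real.pi_pos, le_max_left A 0]

/-- The part of a neighbourhood of the unit sphere in a neighbourhood of the plane orthogonal to
`ζ`. -/
def equatorialBand (ζ : R3) (τ ρ : ℝ) : Set R3 :=
  {u | |‖u‖ ^ 2 - 1| ≤ τ ∧ |inner ℝ ζ u| ≤ ρ * ‖ζ‖}

theorem isClosed_equatorialBand (ζ : R3) (τ ρ : ℝ) : IsClosed (equatorialBand ζ τ ρ) := by
  have h1 : IsClosed {u : R3 | |‖u‖ ^ 2 - 1| ≤ τ} := isClosed_le (by fun_prop) (by fun_prop)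
  have h2 : IsClosed {u : R3 | |inner ℝ ζ u| ≤ ρ * ‖ζ‖} :=
    isClosed_le (by fun_prop) (by fun_prop)
  exact h1.inter h2

/-- Archimedes' hat-box principle: after a reflection taking `ζ` to the first axis, the slice at
height `s` lies between squared radii `1 - s² - τ` and `1 - s² + τ`. Its area is at most `2πτ`
whatever `s` is, and the heights fill an interval of length `2ρ`. -/
theorem volume_equatorialBand_le {ζ : R3} (hζ : ζ ≠ 0) {τ ρ : ℝ} (hρ : 0 ≤ ρ) :
    volume (equatorialBand ζ τ ρ) ≤ ENNReal.ofReal (4 * Real.pi * ρ * τ) := by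
  have hζ' : 0 < ‖ζ‖ := norm_pos_iff.2 hζ
  set e : R3 := EuclideanSpace.single 0 ‖ζ‖ with he
  have hne : ‖ζ‖ = ‖e‖ := by simp [he]
  set R := (ℝ ∙ (ζ - e))ᗮ.reflection with hR
  have hRζ : R ζ = e := Submodule.reflection_sub hne
  have hpre : R ⁻¹' equatorialBand e τ ρ = equatorialBand ζ τ ρ := by
    ext u
    simp only [equatorialBand, Set.mem_preimage, Set.mem_ofPred_eq, R.norm_map, ← hRζ,
      R.inner_map_map]
  rw [← hpre, R.measurePreserving.measure_preimage
    (isClosed_equatorialBand _ _ _).measurableSet.nullMeasurableSet,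
    ← measurePreserving_ofCoords.measure_preimage
    (isClosed_equatorialBand _ _ _).measurableSet.nullMeasurableSet]
  have hm : MeasurableSet (ofCoords ⁻¹' equatorialBand e τ ρ) :=
    measurePreserving_ofCoords.measurable (isClosed_equatorialBand _ _ _).measurableSet
  rw [show (volume : Measure (ℝ × ℝ × ℝ)) = (volume : Measure ℝ).prod volume from rfl,
    Measure.prod_apply hm]
  have hbd : ∀ s : ℝ, volume (Prod.mk s ⁻¹' (ofCoords ⁻¹' equatorialBand e τ ρ)) ≤
      (Set.Icc (-ρ) ρ).indicator (fun _ => ENNReal.ofReal (2 * Real.pi * τ)) s := by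
    intro s
    have hmem : ∀ y : ℝ × ℝ, (s, y) ∈ ofCoords ⁻¹' equatorialBand e τ ρ →
        |s| ≤ ρ ∧ (1 - s ^ 2 - τ ≤ y.1 ^ 2 + y.2 ^ 2 ∧ y.1 ^ 2 + y.2 ^ 2 ≤ 1 - s ^ 2 + τ) := by
      intro y hy
      simp only [equatorialBand, Set.mem_preimage, Set.mem_ofPred_eq, norm_ofCoords_sq,
        inner_ofCoords, ← hne] at hy
      obtain ⟨h1, h2⟩ := hy
      rw [abs_le] at h1
      have h3 : e 0 * s + e 1 * y.1 + e 2 * y.2 = ‖ζ‖ * s := by simp [he]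
      rw [h3, abs_mul, abs_norm, mul_comm] at h2
      exact ⟨le_of_mul_le_mul_right h2 hζ', by linarith, by linarith⟩
    by_cases hsρ : |s| ≤ ρ
    · rw [Set.indicator_of_mem (by rwa [Set.mem_Icc, ← abs_le])]
      refine (measure_mono fun y hy => (hmem y hy).2).trans
        ((volume_annulus_le _ _).trans (le_of_eq ?_))
      congr 1
      ring
    · have : Prod.mk s ⁻¹' (ofCoords ⁻¹' equatorialBand e τ ρ) = ∅ := by
        ext y
        simp only [Set.mem_preimage, Set.mem_empty_iff_false, iff_false]
        exact fun hy => hsρ (hmem y hy).1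
      simp [this]
  refine (lintegral_mono hbd).trans ?_
  rw [lintegral_indicator measurableSet_Icc, setLIntegral_const, Real.volume_Icc,
    ← ENNReal.ofReal_mul' (by linarith)]
  refine le_of_eq ?_
  congr 1
  ring

/-! ### Sobolev inequalities at scale `δ`. -/

section Sobolev

/-- A one-dimensional Sobolev inequality on an interval of length `δ`; here `g` is `δ` times the
derivative of `f`. -/
theorem enorm_sq_le_lintegral_Icc {f g : ℝ → ℂ} {δ : ℝ} (hδ : 0 < δ)
    (hf : ∀ s, HasDerivAt f ((δ⁻¹ : ℝ) * g s) s) (hg : Continuous g) (p : ℝ) :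
    ‖f p‖ₑ ^ 2 ≤ ENNReal.ofReal (2 / δ) *
      ∫⁻ s in Set.Icc p (p + δ), (‖f s‖ₑ ^ 2 + ‖g s‖ₑ ^ 2) := by
  have hfc : Continuous f := continuous_iff_continuousAt.2 fun s => (hf s).continuousAt
  set w : ℝ → ℝ := fun s => 2 * inner ℝ (f s) ((δ⁻¹ : ℝ) * g s) with hw
  have hwc : Continuous w := by fun_prop
  -- The linear weight vanishes at the far endpoint and equals `δ` at `p`, so only the value at `p`
  -- survives integration.
  have hder : ∀ s, HasDerivAt (fun s => -((p + δ - s) * ‖f s‖ ^ 2))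
      (‖f s‖ ^ 2 - (p + δ - s) * w s) s := by
    intro s
    have h1 : HasDerivAt (fun s => p + δ - s) (-1) s := by
      simpa using (hasDerivAt_id s).const_sub (p + δ)
    exact (h1.mul (hf s).norm_sq).neg.congr_deriv (by simp only [hw]; ring)
  have hint := intervalIntegral.integral_eq_sub_of_hasDerivAt (a := p) (b := p + δ)
    (fun s _ => hder s) (by apply Continuous.intervalIntegrable; fun_prop)
  have hval : δ * ‖f p‖ ^ 2 = ∫ s in p..p + δ, (‖f s‖ ^ 2 - (p + δ - s) * w s) := by
    rw [hint]; ring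
  have hle : δ * ‖f p‖ ^ 2 ≤ ∫ s in p..p + δ, 2 * (‖f s‖ ^ 2 + ‖g s‖ ^ 2) := by
    rw [hval]
    refine intervalIntegral.integral_mono_on (by linarith)
      (by apply Continuous.intervalIntegrable; fun_prop)
      (by apply Continuous.intervalIntegrable; fun_prop) fun s hs => ?_
    have h2 : |w s| ≤ 2 * (‖f s‖ * (δ⁻¹ * ‖g s‖)) := by
      have h3 := abs_real_inner_le_norm (f s) ((δ⁻¹ : ℝ) * g s)
      rw [norm_mul, Complex.norm_real, Real.norm_of_nonneg (inv_nonneg.2 hδ.le)] at h3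
      rw [hw, abs_mul, abs_two]
      linarith
    have h4 : 0 ≤ p + δ - s := by linarith [hs.2]
    have h5 : p + δ - s ≤ δ := by linarith [hs.1]
    have h6 : -((p + δ - s) * w s) ≤ δ * (2 * (‖f s‖ * (δ⁻¹ * ‖g s‖))) :=
      calc -((p + δ - s) * w s) ≤ (p + δ - s) * |w s| := by
            nlinarith [neg_abs_le (w s)]
        _ ≤ δ * (2 * (‖f s‖ * (δ⁻¹ * ‖g s‖))) :=
            mul_le_mul h5 h2 (abs_nonneg _) hδ.le
    have h7 : δ * (2 * (‖f s‖ * (δ⁻¹ * ‖g s‖))) = 2 * ‖f s‖ * ‖g s‖ := by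
      field_simp
    nlinarith [sq_nonneg (‖f s‖ - ‖g s‖), sq_nonneg (‖g s‖)]
  have hle' : ‖f p‖ ^ 2 ≤ (2 / δ) * ∫ s in Set.Icc p (p + δ), (‖f s‖ ^ 2 + ‖g s‖ ^ 2) := by
    rw [intervalIntegral.integral_const_mul, intervalIntegral.integral_of_le (by linarith),
      ← integral_Icc_eq_integral_Ioc] at hle
    rw [div_mul_eq_mul_div, le_div_iff₀ hδ]
    linarith
  have e1 : ∀ z : ℂ, ‖z‖ₑ ^ 2 = ENNReal.ofReal (‖z‖ ^ 2) := fun z => by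
    rw [ENNReal.ofReal_pow (norm_nonneg _), ofReal_norm]
  rw [e1]
  refine (ENNReal.ofReal_le_ofReal hle').trans ?_
  rw [ENNReal.ofReal_mul (by positivity), ofReal_integral_eq_lintegral_ofReal]
  · refine le_of_eq ?_
    congr 1
    refine lintegral_congr fun s => ?_
    rw [e1, e1, ENNReal.ofReal_add (by positivity) (by positivity)]
  · exact (Continuous.continuousOn (by fun_prop)).integrableOn_Icc
  · exact Filter.Eventually.of_forall fun s => by positivity

/-- Superadditivity of the lower integral needs no measurability, so none is required of the partial
integrals in the iteration below. -/
theorem sum_range_two_lintegral_le {α : Type*} [MeasurableSpace α] (μ : Measure α)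
    (F : ℕ → α → ℝ≥0∞) :
    ∑ i ∈ Finset.range 2, ∫⁻ a, F i a ∂μ ≤ ∫⁻ a, ∑ i ∈ Finset.range 2, F i a ∂μ := by
  simp only [Finset.sum_range_succ, Finset.sum_range_zero, zero_add]
  exact le_lintegral_add _ _

/-- A three-dimensional Sobolev inequality on a cube of side `δ`, with mixed first derivatives:
`g i j l` is `δ^(i + j + l)` times the `i, j, l`-th mixed derivative of `g 0 0 0`. -/
theorem enorm_sq_le_lintegral_cube {g : ℕ → ℕ → ℕ → ℝ → ℝ → ℝ → ℂ} {δ : ℝ} (hδ : 0 < δ)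
    (h₁ : ∀ i j l a b c,
      HasDerivAt (fun s => g i j l s b c) ((δ⁻¹ : ℝ) * g (i + 1) j l a b c) a)
    (h₂ : ∀ i j l a b c,
      HasDerivAt (fun s => g i j l a s c) ((δ⁻¹ : ℝ) * g i (j + 1) l a b c) b)
    (h₃ : ∀ i j l a b c,
      HasDerivAt (fun s => g i j l a b s) ((δ⁻¹ : ℝ) * g i j (l + 1) a b c) c)
    (p q r : ℝ) :
    ‖g 0 0 0 p q r‖ₑ ^ 2 ≤ ENNReal.ofReal (2 / δ) ^ 3 *
      ∫⁻ a in Set.Icc p (p + δ), ∫⁻ b in Set.Icc q (q + δ), ∫⁻ c in Set.Icc r (r + δ),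
        ∑ i ∈ Finset.range 2, ∑ j ∈ Finset.range 2, ∑ l ∈ Finset.range 2,
          ‖g i j l a b c‖ₑ ^ 2 := by
  set K := ENNReal.ofReal (2 / δ) with hK
  have hKt : K ≠ ⊤ := ENNReal.ofReal_ne_top
  have c₁ : ∀ i j l b c, Continuous fun s => g i j l s b c := fun i j l b c =>
    continuous_iff_continuousAt.2 fun a => (h₁ i j l a b c).continuousAt
  have c₂ : ∀ i j l a c, Continuous fun s => g i j l a s c := fun i j l a c =>
    continuous_iff_continuousAt.2 fun b => (h₂ i j l a b c).continuousAt
  have c₃ : ∀ i j l a b, Continuous fun s => g i j l a b s := fun i j l a b =>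
    continuous_iff_continuousAt.2 fun c => (h₃ i j l a b c).continuousAt
  have s₃ : ∀ i j a b, ‖g i j 0 a b r‖ₑ ^ 2 ≤ K * ∫⁻ c in Set.Icc r (r + δ),
      ∑ l ∈ Finset.range 2, ‖g i j l a b c‖ₑ ^ 2 := by
    intro i j a b
    simpa [Finset.sum_range_succ] using
      enorm_sq_le_lintegral_Icc hδ (fun c => h₃ i j 0 a b c) (c₃ i j 1 a b) r
  have s₂ : ∀ i a, ‖g i 0 0 a q r‖ₑ ^ 2 ≤ K ^ 2 * ∫⁻ b in Set.Icc q (q + δ),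
      ∫⁻ c in Set.Icc r (r + δ),
        ∑ j ∈ Finset.range 2, ∑ l ∈ Finset.range 2, ‖g i j l a b c‖ₑ ^ 2 := by
    intro i a
    have h : ‖g i 0 0 a q r‖ₑ ^ 2 ≤ K * ∫⁻ b in Set.Icc q (q + δ),
        ∑ j ∈ Finset.range 2, ‖g i j 0 a b r‖ₑ ^ 2 := by
      simpa [Finset.sum_range_succ] using
        enorm_sq_le_lintegral_Icc hδ (fun b => h₂ i 0 0 a b r) (c₂ i 1 0 a r) q
    refine h.trans ?_
    rw [pow_two, mul_assoc]
    refine mul_le_mul_right ?_ _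
    rw [← lintegral_const_mul' K _ hKt]
    refine lintegral_mono fun b => ?_
    refine (Finset.sum_le_sum fun j _ => s₃ i j a b).trans ?_
    rw [← Finset.mul_sum]
    exact mul_le_mul_right (sum_range_two_lintegral_le _ _) _
  have h : ‖g 0 0 0 p q r‖ₑ ^ 2 ≤ K * ∫⁻ a in Set.Icc p (p + δ),
      ∑ i ∈ Finset.range 2, ‖g i 0 0 a q r‖ₑ ^ 2 := by
    simpa [Finset.sum_range_succ] using
      enorm_sq_le_lintegral_Icc hδ (fun a => h₁ 0 0 0 a q r) (c₁ 1 0 0 q r) p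
  refine h.trans ?_
  rw [pow_succ', mul_assoc, ← lintegral_const_mul' (K ^ 2) _ (ENNReal.pow_ne_top hKt)]
  refine mul_le_mul_right (lintegral_mono fun a => ?_) _
  refine (Finset.sum_le_sum fun i _ => s₂ i a).trans ?_
  rw [← Finset.mul_sum]
  refine mul_le_mul_right ((sum_range_two_lintegral_le _ _).trans
    (lintegral_mono fun b => sum_range_two_lintegral_le _ _)) _

end Sobolev

/-! ### Symbols depending on a direction, and their derivatives in it. -/

section Symbol

/-- Differentiation under the integral sign for integrals of `H ζ * m (τ ζ + s * ℓ ζ)`. -/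
theorem hasDerivAt_integral_mul_comp {H : R3 → ℂ} {τ ℓ : R3 → ℝ} (hτ : Continuous τ)
    (hℓ : Continuous ℓ) (hH : Integrable H) (hHℓ : Integrable fun ζ => H ζ * (ℓ ζ : ℂ))
    {m m' : ℝ → ℂ} (hm : ∀ s, HasDerivAt m (m' s) s) (hm' : Continuous m') {B B' : ℝ}
    (hB : ∀ s, ‖m s‖ ≤ B) (hB' : ∀ s, ‖m' s‖ ≤ B') (s : ℝ) :
    HasDerivAt (fun s => ∫ ζ, H ζ * m (τ ζ + s * ℓ ζ))
      (∫ ζ, H ζ * (ℓ ζ : ℂ) * m' (τ ζ + s * ℓ ζ)) s := by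
  have hmc : Continuous m := continuous_iff_continuousAt.2 fun s => (hm s).continuousAt
  refine (hasDerivAt_integral_of_dominated_loc_of_deriv_le
    (F := fun s ζ => H ζ * m (τ ζ + s * ℓ ζ)) (F' := fun s ζ => H ζ * (ℓ ζ : ℂ) *
      m' (τ ζ + s * ℓ ζ)) (bound := fun ζ => ‖H ζ * (ℓ ζ : ℂ)‖ * B')
    Filter.univ_mem ?_ ?_ ?_ ?_ (hHℓ.norm.mul_const _) ?_).2
  · exact Filter.Eventually.of_forall fun s =>
      hH.aestronglyMeasurable.mul (Continuous.aestronglyMeasurable (by fun_prop))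
  · exact hH.mul_bdd (Continuous.aestronglyMeasurable (by fun_prop))
      (Filter.Eventually.of_forall fun ζ => hB _)
  · exact hHℓ.aestronglyMeasurable.mul (Continuous.aestronglyMeasurable (by fun_prop))
  · refine Filter.Eventually.of_forall fun ζ t _ => ?_
    rw [norm_mul]
    exact mul_le_mul_of_nonneg_left (hB' _) (norm_nonneg _)
  · refine Filter.Eventually.of_forall fun ζ t _ => ?_
    have h1 : HasDerivAt (fun t : ℝ => τ ζ + t * ℓ ζ) (ℓ ζ) t := by
      simpa using ((hasDerivAt_id t).mul_const (ℓ ζ)).const_add (τ ζ)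
    exact (((hm (τ ζ + t * ℓ ζ)).scomp t h1).const_mul (H ζ)).congr_deriv
      (by rw [Complex.real_smul]; ring)

/-- The symbol `h(ζ) (δζ)^(i, j, l) m_{i+j+l}(ζ · u)`. If `m_n` is the `n`-th derivative of
`m_0`, this is `δ^(i + j + l)` times a mixed derivative in `u` of `h(ζ) m_0(ζ · u)`. -/
noncomputable def dirSymbol (h : R3 → ℂ) (m : ℕ → ℝ → ℂ) (δ : ℝ) (i j l : ℕ) (u ζ : R3) : ℂ :=
  h ζ * (((δ * ζ 0) ^ i * (δ * ζ 1) ^ j * (δ * ζ 2) ^ l : ℝ) : ℂ) * m (i + j + l) (inner ℝ ζ u)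

variable {h : R3 → ℂ} {m : ℕ → ℝ → ℂ} {δ : ℝ} {B : ℕ → ℝ}

/-- Each `|δ ζ_n|` is at most `1` on the support of `h`. This is what makes `δ` the right side
length for the Sobolev cube. -/
theorem norm_mul_monomial_le (hδ : 0 < δ) (hs : ∀ ζ, h ζ ≠ 0 → ‖ζ‖ ≤ δ⁻¹) (i j l : ℕ) (ζ : R3) :
    ‖h ζ * (((δ * ζ 0) ^ i * (δ * ζ 1) ^ j * (δ * ζ 2) ^ l : ℝ) : ℂ)‖ ≤ ‖h ζ‖ := by
  by_cases hz : h ζ = 0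
  · simp [hz]
  have h1 : ∀ n : Fin 3, |δ * ζ n| ≤ 1 := by
    intro n
    have h2 : ‖ζ n‖ ≤ ‖ζ‖ := PiLp.norm_apply_le ζ n
    rw [Real.norm_eq_abs] at h2
    rw [abs_mul, abs_of_pos hδ]
    calc δ * |ζ n| ≤ δ * δ⁻¹ := mul_le_mul_of_nonneg_left (h2.trans (hs ζ hz)) hδ.le
      _ = 1 := mul_inv_cancel₀ hδ.ne'
  rw [norm_mul, Complex.norm_real, Real.norm_eq_abs, abs_mul, abs_mul, abs_pow, abs_pow, abs_pow]
  have h3 : ∀ (n : Fin 3) (e : ℕ), |δ * ζ n| ^ e ≤ 1 := fun n e =>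
    pow_le_one₀ (abs_nonneg _) (h1 n)
  refine mul_le_of_le_one_right (norm_nonneg _) ?_
  exact mul_le_one₀ (mul_le_one₀ (h3 0 i) (by positivity) (h3 1 j)) (by positivity) (h3 2 l)

theorem norm_dirSymbol_le (hδ : 0 < δ) (hs : ∀ ζ, h ζ ≠ 0 → ‖ζ‖ ≤ δ⁻¹)
    (hB : ∀ n s, ‖m n s‖ ≤ B n) (i j l : ℕ) (u ζ : R3) :
    ‖dirSymbol h m δ i j l u ζ‖ ≤ ‖h ζ‖ * B (i + j + l) := by
  rw [dirSymbol, norm_mul]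
  exact mul_le_mul (norm_mul_monomial_le hδ hs i j l ζ) (hB _ _) (norm_nonneg _) (norm_nonneg _)

theorem aestronglyMeasurable_mul_monomial (hh : AEStronglyMeasurable h) (i j l : ℕ) :
    AEStronglyMeasurable fun ζ : R3 =>
      h ζ * (((δ * ζ 0) ^ i * (δ * ζ 1) ^ j * (δ * ζ 2) ^ l : ℝ) : ℂ) :=
  hh.mul (Continuous.aestronglyMeasurable (by fun_prop))

theorem aestronglyMeasurable_dirSymbol (hh : AEStronglyMeasurable h) (hm : ∀ n, Continuous (m n))
    (i j l : ℕ) (u : R3) : AEStronglyMeasurable (dirSymbol h m δ i j l u) := by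
  have := hm (i + j + l)
  exact (aestronglyMeasurable_mul_monomial hh i j l).mul
    (Continuous.aestronglyMeasurable (by fun_prop))

theorem integrable_dirSymbol (hδ : 0 < δ) (hs : ∀ ζ, h ζ ≠ 0 → ‖ζ‖ ≤ δ⁻¹) (hh : Integrable h)
    (hm : ∀ n, Continuous (m n)) (hB : ∀ n s, ‖m n s‖ ≤ B n) (i j l : ℕ) (u : R3) :
    Integrable (dirSymbol h m δ i j l u) :=
  (hh.norm.mul_const (B (i + j + l))).mono'
    (aestronglyMeasurable_dirSymbol hh.aestronglyMeasurable hm i j l u)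
    (Filter.Eventually.of_forall fun ζ => norm_dirSymbol_le hδ hs hB i j l u ζ)

theorem memLp_dirSymbol (hδ : 0 < δ) (hs : ∀ ζ, h ζ ≠ 0 → ‖ζ‖ ≤ δ⁻¹) (hh : MemLp h 2 volume)
    (hm : ∀ n, Continuous (m n)) (hB : ∀ n s, ‖m n s‖ ≤ B n) (i j l : ℕ) (u : R3) :
    MemLp (dirSymbol h m δ i j l u) 2 volume :=
  hh.of_le_mul (c := B (i + j + l))
    (aestronglyMeasurable_dirSymbol hh.aestronglyMeasurable hm i j l u)
    (Filter.Eventually.of_forall fun ζ => by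
      rw [mul_comm]; exact norm_dirSymbol_le hδ hs hB i j l u ζ)

/-- Joint continuity in direction and position supplies the measurability needed for Tonelli in the
sphere majorant. -/
theorem continuous_fourierInv_dirSymbol (hδ : 0 < δ) (hs : ∀ ζ, h ζ ≠ 0 → ‖ζ‖ ≤ δ⁻¹)
    (hh : Integrable h) (hm : ∀ n, Continuous (m n)) (hB : ∀ n s, ‖m n s‖ ≤ B n) (i j l : ℕ) :
    Continuous fun p : R3 × R3 => 𝓕⁻ (dirSymbol h m δ i j l p.1) p.2 := by
  simp only [Real.fourierInv_eq]
  refine continuous_of_dominated (bound := fun ζ => ‖h ζ‖ * B (i + j + l)) (fun p => ?_)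
    (fun p => Filter.Eventually.of_forall fun ζ => ?_) (hh.norm.mul_const _)
    (Filter.Eventually.of_forall fun ζ => ?_)
  · simp only [Circle.smul_def]
    have hc : Continuous fun ζ : R3 => (Real.fourierChar (inner ℝ ζ p.2) : ℂ) := by
      have := Real.continuous_fourierChar
      fun_prop
    exact hc.aestronglyMeasurable.smul
      (aestronglyMeasurable_dirSymbol hh.aestronglyMeasurable hm i j l p.1)
  · rw [Circle.norm_smul]
    exact norm_dirSymbol_le hδ hs hB i j l p.1 ζ
  · have := hm (i + j + l)
    have := Real.continuous_fourierChar
    simp only [Circle.smul_def, dirSymbol]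
    fun_prop

/-- Moving `u` along the `n`-th axis differentiates `m` and produces `ζ n = δ⁻¹ (δ ζ n)`, which
raises one exponent. The abstract exponents `i' j' l'` let one proof serve all three axes. -/
theorem hasDerivAt_fourierInv_dirSymbol (hδ : 0 < δ) (hs : ∀ ζ, h ζ ≠ 0 → ‖ζ‖ ≤ δ⁻¹)
    (hh : Integrable h) (hm : ∀ n s, HasDerivAt (m n) (m (n + 1) s) s)
    (hB : ∀ n s, ‖m n s‖ ≤ B n) (i j l : ℕ) (x : R3) (u : ℝ → R3) (n : Fin 3) (τ : R3 → ℝ)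
    (hτ : Continuous τ) (hu : ∀ ζ s, inner ℝ ζ (u s) = τ ζ + s * ζ n) (i' j' l' : ℕ)
    (hsum : i' + j' + l' = i + j + l + 1)
    (hmon : ∀ ζ : R3, (δ * ζ 0) ^ i' * (δ * ζ 1) ^ j' * (δ * ζ 2) ^ l' =
      (δ * ζ 0) ^ i * (δ * ζ 1) ^ j * (δ * ζ 2) ^ l * (δ * ζ n)) (s : ℝ) :
    HasDerivAt (fun s => 𝓕⁻ (dirSymbol h m δ i j l (u s)) x)
      ((δ⁻¹ : ℝ) * 𝓕⁻ (dirSymbol h m δ i' j' l' (u s)) x) s := by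
  have hmc : ∀ n, Continuous (m n) := fun n =>
    continuous_iff_continuousAt.2 fun s => (hm n s).continuousAt
  have hδ' : (δ : ℂ) ≠ 0 := by exact_mod_cast hδ.ne'
  set H : ℕ → ℕ → ℕ → R3 → ℂ := fun i j l ζ => (Real.fourierChar (inner ℝ ζ x) : ℂ) *
    (h ζ * (((δ * ζ 0) ^ i * (δ * ζ 1) ^ j * (δ * ζ 2) ^ l : ℝ) : ℂ)) with hH
  have hHint : ∀ i j l, Integrable (H i j l) := by
    intro i j l
    refine hh.norm.mono' ?_ (Filter.Eventually.of_forall fun ζ => ?_)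
    · refine AEStronglyMeasurable.mul (Continuous.aestronglyMeasurable ?_)
        (aestronglyMeasurable_mul_monomial hh.aestronglyMeasurable i j l)
      have := Real.continuous_fourierChar
      fun_prop
    · rw [hH, norm_mul, Circle.norm_coe, one_mul]
      exact norm_mul_monomial_le hδ hs i j l ζ
  have hHn : ∀ ζ, H i j l ζ * (ζ n : ℂ) = (δ⁻¹ : ℝ) * H i' j' l' ζ := by
    intro ζ
    simp only [hH, hmon ζ]
    push_cast
    field_simp
  have hd := hasDerivAt_integral_mul_comp (H := H i j l) (τ := τ) (ℓ := fun ζ => ζ n) hτ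
    (by fun_prop) (hHint i j l) (by simp only [hHn]; exact (hHint i' j' l').const_mul _)
    (hm (i + j + l)) (hmc _) (hB _) (hB _) s
  convert hd using 1
  · funext s
    rw [Real.fourierInv_eq]
    refine integral_congr_ae (Filter.Eventually.of_forall fun ζ => ?_)
    simp only [Circle.smul_def, dirSymbol, hH, hu, smul_eq_mul]
    ring
  · rw [Real.fourierInv_eq, ← integral_const_mul]
    refine integral_congr_ae (Filter.Eventually.of_forall fun ζ => ?_)
    simp only [hHn]
    simp only [Circle.smul_def, dirSymbol, hH, hu, smul_eq_mul, hsum]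
    ring

/-- Pointwise control of the multiplier operators with symbols `h(ζ) m_0(ζ · v)` by averages over
a cube at `v`. -/
theorem enorm_sq_fourierInv_dirSymbol_le (hδ : 0 < δ) (hs : ∀ ζ, h ζ ≠ 0 → ‖ζ‖ ≤ δ⁻¹)
    (hh : Integrable h) (hm : ∀ n s, HasDerivAt (m n) (m (n + 1) s) s)
    (hB : ∀ n s, ‖m n s‖ ≤ B n) {A : Set R3} (hA : MeasurableSet A) {v : R3}
    (hvA : ∀ u : R3, (∀ n, u n ∈ Set.Icc (v n) (v n + δ)) → u ∈ A) (x : R3) :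
    ‖𝓕⁻ (dirSymbol h m δ 0 0 0 v) x‖ₑ ^ 2 ≤ ENNReal.ofReal (2 / δ) ^ 3 *
      ∫⁻ u in A, ∑ i ∈ Finset.range 2, ∑ j ∈ Finset.range 2, ∑ l ∈ Finset.range 2,
        ‖𝓕⁻ (dirSymbol h m δ i j l u) x‖ₑ ^ 2 := by
  have hmc : ∀ n, Continuous (m n) := fun n =>
    continuous_iff_continuousAt.2 fun s => (hm n s).continuousAt
  have hsob := enorm_sq_le_lintegral_cube
    (g := fun i j l a b c => 𝓕⁻ (dirSymbol h m δ i j l (ofCoords (a, b, c))) x) hδ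
    (fun i j l a b c => hasDerivAt_fourierInv_dirSymbol hδ hs hh hm hB i j l x
      (fun s => ofCoords (s, b, c)) 0 (fun ζ => ζ 1 * b + ζ 2 * c) (by fun_prop)
      (fun ζ s => by rw [inner_ofCoords]; ring) (i + 1) j l (by ring) (fun ζ => by ring) a)
    (fun i j l a b c => hasDerivAt_fourierInv_dirSymbol hδ hs hh hm hB i j l x
      (fun s => ofCoords (a, s, c)) 1 (fun ζ => ζ 0 * a + ζ 2 * c) (by fun_prop)
      (fun ζ s => by rw [inner_ofCoords]; ring) i (j + 1) l (by ring) (fun ζ => by ring) b)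
    (fun i j l a b c => hasDerivAt_fourierInv_dirSymbol hδ hs hh hm hB i j l x
      (fun s => ofCoords (a, b, s)) 2 (fun ζ => ζ 0 * a + ζ 1 * b) (by fun_prop)
      (fun ζ s => by rw [inner_ofCoords]; ring) i j (l + 1) (by ring) (fun ζ => by ring) c)
    (v 0) (v 1) (v 2)
  rw [ofCoords_coords] at hsob
  refine hsob.trans (mul_le_mul_right ?_ _)
  set Φ : R3 → ℝ≥0∞ := fun u => ∑ i ∈ Finset.range 2, ∑ j ∈ Finset.range 2,
    ∑ l ∈ Finset.range 2, ‖𝓕⁻ (dirSymbol h m δ i j l u) x‖ₑ ^ 2 with hΦ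
  have hΦm : Measurable Φ := by
    refine Finset.measurable_fun_sum _ fun i _ => Finset.measurable_fun_sum _ fun j _ =>
      Finset.measurable_fun_sum _ fun l _ => ?_
    have := (continuous_fourierInv_dirSymbol hδ hs hh hmc hB i j l).comp
      (Continuous.prodMk_left x)
    exact this.measurable.enorm.pow_const 2
  have hΦc : Measurable fun p => Φ (ofCoords p) := hΦm.comp measurePreserving_ofCoords.measurable
  rw [← measurePreserving_ofCoords.setLIntegral_comp_preimage hA hΦm]
  calc _ = ∫⁻ p in Set.Icc (v 0) (v 0 + δ) ×ˢ (Set.Icc (v 1) (v 1 + δ) ×ˢ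
        Set.Icc (v 2) (v 2 + δ)), Φ (ofCoords p) := by
        rw [show (volume : Measure (ℝ × ℝ × ℝ)) = (volume : Measure ℝ).prod
          ((volume : Measure ℝ).prod volume) from rfl, ← Measure.prod_restrict,
          ← Measure.prod_restrict, lintegral_prod _ hΦc.aemeasurable]
        refine lintegral_congr fun a => ?_
        rw [lintegral_prod (fun y => Φ (ofCoords (a, y)))
          (hΦc.comp measurable_prodMk_left).aemeasurable]
    _ ≤ _ := by
        refine lintegral_mono_set fun p hp => hvA _ fun n => ?_
        fin_cases n
        · exact hp.1
        · exact hp.2.1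
        · exact hp.2.2

end Symbol

/-! ### Majorants for the maximal function in the two regimes. -/

section Majorant

variable {h : R3 → ℂ} {m : ℕ → ℝ → ℂ} {δ b : ℝ} {B : ℕ → ℝ}

/-- Where the symbol is nonzero, `|ζ · u| ≤ 1/(2π) ≤ 2δ‖ζ‖`: the lower frequency bound turns a slab
of fixed width into a condition on the angle alone. -/
theorem enorm_dirSymbol_sq_le (hδ : 0 < δ) (hs : ∀ ζ, h ζ ≠ 0 → ‖ζ‖ ≤ δ⁻¹)
    (hs' : ∀ ζ, h ζ ≠ 0 → (2 * Real.pi)⁻¹ ≤ 2 * δ * ‖ζ‖)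
    (hB : ∀ n s, ‖m n s‖ ≤ B n) (hm0 : ∀ n s, m n s ≠ 0 → |s| ≤ (2 * Real.pi)⁻¹)
    {i j l : ℕ} (hb : B (i + j + l) ≤ b) (u ζ : R3) :
    ‖dirSymbol h m δ i j l u ζ‖ₑ ^ 2 ≤ ENNReal.ofReal (b ^ 2) *
      (‖h ζ‖ₑ ^ 2 * {p : R3 × R3 | |inner ℝ p.2 p.1| ≤ 2 * δ * ‖p.2‖}.indicator 1 (u, ζ)) := by
  by_cases hz : h ζ = 0
  · simp [dirSymbol, hz]
  by_cases hmz : m (i + j + l) (inner ℝ ζ u) = 0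
  · simp [dirSymbol, hmz]
  have hmem : (u, ζ) ∈ {p : R3 × R3 | |inner ℝ p.2 p.1| ≤ 2 * δ * ‖p.2‖} :=
    (hm0 _ _ hmz).trans (hs' ζ hz)
  have hb0 : 0 ≤ b := ((norm_nonneg _).trans (hB (i + j + l) 0)).trans hb
  have h1 : ‖dirSymbol h m δ i j l u ζ‖ ≤ b * ‖h ζ‖ := by
    rw [mul_comm]
    exact (norm_dirSymbol_le hδ hs hB i j l u ζ).trans
      (mul_le_mul_of_nonneg_left hb (norm_nonneg _))
  have h2 : ‖dirSymbol h m δ i j l u ζ‖ₑ ≤ ENNReal.ofReal b * ‖h ζ‖ₑ := by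
    rw [← ofReal_norm, ← ofReal_norm, ← ENNReal.ofReal_mul hb0]
    exact ENNReal.ofReal_le_ofReal h1
  rw [Set.indicator_of_mem hmem, Pi.one_apply, mul_one, ENNReal.ofReal_pow hb0, ← mul_pow]
  gcongr

theorem ne_zero_of_slab (hs' : ∀ ζ, h ζ ≠ 0 → (2 * Real.pi)⁻¹ ≤ 2 * δ * ‖ζ‖) {ζ : R3}
    (hz : h ζ ≠ 0) : ζ ≠ 0 := by
  rintro rfl
  have := hs' 0 hz
  rw [norm_zero, mul_zero] at this
  exact absurd this (not_le.2 (by positivity))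

theorem measurableSet_slab (δ : ℝ) :
    MeasurableSet {p : R3 × R3 | |inner ℝ p.2 p.1| ≤ 2 * δ * ‖p.2‖} := by
  have h1 : IsClosed {p : R3 × R3 | |inner ℝ p.2 p.1| ≤ 2 * δ * ‖p.2‖} :=
    isClosed_le (by fun_prop) (by fun_prop)
  exact h1.measurableSet

/-- Plancherel in `x` for each of the eight mixed derivatives, all dominated by the same slab. -/
theorem lintegral_sum_enorm_fourierInv_dirSymbol_le (hδ : 0 < δ)
    (hs : ∀ ζ, h ζ ≠ 0 → ‖ζ‖ ≤ δ⁻¹) (hs' : ∀ ζ, h ζ ≠ 0 → (2 * Real.pi)⁻¹ ≤ 2 * δ * ‖ζ‖)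
    (hh : Integrable h) (hh2 : MemLp h 2 volume) (hmc : ∀ n, Continuous (m n))
    (hB : ∀ n s, ‖m n s‖ ≤ B n) (hm0 : ∀ n s, m n s ≠ 0 → |s| ≤ (2 * Real.pi)⁻¹)
    (hb : ∀ n ≤ 3, B n ≤ b) (u : R3) :
    ∫⁻ x, ∑ i ∈ Finset.range 2, ∑ j ∈ Finset.range 2, ∑ l ∈ Finset.range 2,
        ‖𝓕⁻ (dirSymbol h m δ i j l u) x‖ₑ ^ 2 ≤
      ENNReal.ofReal (8 * b ^ 2) * ∫⁻ ζ, ‖h ζ‖ₑ ^ 2 *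
        {p : R3 × R3 | |inner ℝ p.2 p.1| ≤ 2 * δ * ‖p.2‖}.indicator 1 (u, ζ) := by
  set I : ℝ≥0∞ := ∫⁻ ζ, ‖h ζ‖ₑ ^ 2 *
    {p : R3 × R3 | |inner ℝ p.2 p.1| ≤ 2 * δ * ‖p.2‖}.indicator 1 (u, ζ) with hI
  have hone : ∀ i ∈ Finset.range 2, ∀ j ∈ Finset.range 2, ∀ l ∈ Finset.range 2,
      ∫⁻ x, ‖𝓕⁻ (dirSymbol h m δ i j l u) x‖ₑ ^ 2 ≤ ENNReal.ofReal (b ^ 2) * I := by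
    intro i hi j hj l hl
    rw [Finset.mem_range] at hi hj hl
    rw [lintegral_enorm_fourierInv_sq (integrable_dirSymbol hδ hs hh hmc hB i j l u)
      (memLp_dirSymbol hδ hs hh2 hmc hB i j l u), hI,
      ← lintegral_const_mul' _ _ ENNReal.ofReal_ne_top]
    exact lintegral_mono fun ζ =>
      enorm_dirSymbol_sq_le hδ hs hs' hB hm0 (hb _ (by omega)) u ζ
  have hterm : ∀ i j l : ℕ, Measurable fun x : R3 =>
      ‖𝓕⁻ (dirSymbol h m δ i j l u) x‖ₑ ^ 2 := fun i j l =>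
    (continuous_fourierInv
      (integrable_dirSymbol hδ hs hh hmc hB i j l u)).measurable.enorm.pow_const 2
  rw [lintegral_finsetSum _ fun i _ => Finset.measurable_fun_sum _ fun j _ =>
    Finset.measurable_fun_sum _ fun l _ => hterm i j l]
  have hsum : ∀ i, ∫⁻ x, ∑ j ∈ Finset.range 2, ∑ l ∈ Finset.range 2,
      ‖𝓕⁻ (dirSymbol h m δ i j l u) x‖ₑ ^ 2 = ∑ j ∈ Finset.range 2, ∑ l ∈ Finset.range 2,
      ∫⁻ x, ‖𝓕⁻ (dirSymbol h m δ i j l u) x‖ₑ ^ 2 := by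
    intro i
    rw [lintegral_finsetSum _ fun j _ => Finset.measurable_fun_sum _ fun l _ => hterm i j l]
    refine Finset.sum_congr rfl fun j _ => ?_
    rw [lintegral_finsetSum _ fun l _ => hterm i j l]
  simp only [hsum]
  refine (Finset.sum_le_sum fun i hi => Finset.sum_le_sum fun j hj =>
    Finset.sum_le_sum fun l hl => hone i hi j hj l hl).trans (le_of_eq ?_)
  simp only [Finset.sum_const, Finset.card_range, nsmul_eq_mul]
  rw [ENNReal.ofReal_mul (by norm_num)]
  simp only [← mul_assoc]
  norm_num

theorem lintegral_shell_slab_le {ζ : R3} (hζ : ζ ≠ 0) (hδ : 0 < δ) :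
    ∫⁻ u in {u : R3 | |‖u‖ ^ 2 - 1| ≤ 8 * δ},
        {p : R3 × R3 | |inner ℝ p.2 p.1| ≤ 2 * δ * ‖p.2‖}.indicator 1 (u, ζ) ≤
      ENNReal.ofReal (64 * Real.pi * δ ^ 2) := by
  have hms : MeasurableSet {u : R3 | |inner ℝ ζ u| ≤ 2 * δ * ‖ζ‖} :=
    (isClosed_le (f := fun u : R3 => |inner ℝ ζ u|) (g := fun _ => 2 * δ * ‖ζ‖) (by fun_prop)
      (by fun_prop)).measurableSet
  have hslice : ∀ u : R3, {p : R3 × R3 | |inner ℝ p.2 p.1| ≤ 2 * δ * ‖p.2‖}.indicator 1 (u, ζ) =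
      {u : R3 | |inner ℝ ζ u| ≤ 2 * δ * ‖ζ‖}.indicator (1 : R3 → ℝ≥0∞) u := fun u => rfl
  simp only [hslice]
  rw [lintegral_indicator_one hms, Measure.restrict_apply hms, Set.inter_comm]
  refine (volume_equatorialBand_le hζ (τ := 8 * δ) (ρ := 2 * δ) (by positivity)).trans
    (le_of_eq ?_)
  congr 1
  ring

/-- At frequencies comparable to `δ⁻¹` the maximal function over all directions costs at most
`δ⁻¹` in the square of the `L²` norm. -/
theorem exists_majorant_sphere (hδ : 0 < δ) (hδ1 : δ ≤ 1) (hs : ∀ ζ, h ζ ≠ 0 → ‖ζ‖ ≤ δ⁻¹)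
    (hs' : ∀ ζ, h ζ ≠ 0 → (2 * Real.pi)⁻¹ ≤ 2 * δ * ‖ζ‖)
    (hh : Integrable h) (hh2 : MemLp h 2 volume)
    (hm : ∀ n s, HasDerivAt (m n) (m (n + 1) s) s)
    (hB : ∀ n s, ‖m n s‖ ≤ B n) (hm0 : ∀ n s, m n s ≠ 0 → |s| ≤ (2 * Real.pi)⁻¹)
    (hb : ∀ n ≤ 3, B n ≤ b) :
    ∃ D : R3 → ℝ≥0∞,
      (∀ v : R3, ‖v‖ = 1 → ∀ x, ‖𝓕⁻ (dirSymbol h m δ 0 0 0 v) x‖ₑ ^ 2 ≤ D x) ∧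
      ∫⁻ x, D x ≤ ENNReal.ofReal (4096 * Real.pi * b ^ 2 / δ) * ∫⁻ ζ, ‖h ζ‖ₑ ^ 2 := by
  have hmc : ∀ n, Continuous (m n) := fun n =>
    continuous_iff_continuousAt.2 fun s => (hm n s).continuousAt
  set A : Set R3 := {u | |‖u‖ ^ 2 - 1| ≤ 8 * δ} with hA
  have hAm : MeasurableSet A :=
    (isClosed_le (f := fun u : R3 => |‖u‖ ^ 2 - 1|) (g := fun _ => 8 * δ) (by fun_prop)
      (by fun_prop)).measurableSet
  set Φ : R3 → R3 → ℝ≥0∞ := fun u x => ∑ i ∈ Finset.range 2, ∑ j ∈ Finset.range 2,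
    ∑ l ∈ Finset.range 2, ‖𝓕⁻ (dirSymbol h m δ i j l u) x‖ₑ ^ 2 with hΦ
  have hterm : ∀ i j l : ℕ, Measurable fun p : R3 × R3 =>
      ‖𝓕⁻ (dirSymbol h m δ i j l p.1) p.2‖ₑ ^ 2 := fun i j l =>
    (continuous_fourierInv_dirSymbol hδ hs hh hmc hB i j l).measurable.enorm.pow_const 2
  have hΦm : Measurable (Function.uncurry Φ) :=
    Finset.measurable_fun_sum _ fun i _ => Finset.measurable_fun_sum _ fun j _ =>
      Finset.measurable_fun_sum _ fun l _ => hterm i j l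
  refine ⟨fun x => ENNReal.ofReal (2 / δ) ^ 3 * ∫⁻ u in A, Φ u x, fun v hv x => ?_, ?_⟩
  · refine enorm_sq_fourierInv_dirSymbol_le hδ hs hh hm hB hAm (fun u hu => ?_) x
    have h1 : ‖u - v‖ ≤ 2 * δ := by
      have h2 : ‖u - v‖ ^ 2 ≤ (2 * δ) ^ 2 := by
        rw [EuclideanSpace.norm_sq_eq, Fin.sum_univ_three]
        have h3 : ∀ n : Fin 3, ‖(u - v) n‖ ^ 2 ≤ δ ^ 2 := by
          intro n
          rw [Real.norm_eq_abs, sq_abs, PiLp.sub_apply]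
          have := hu n
          exact pow_le_pow_left₀ (by linarith [this.1]) (by linarith [this.2]) 2
        nlinarith [h3 0, h3 1, h3 2]
      exact le_of_sq_le_sq h2 (by positivity)
    have h4 := abs_norm_sub_norm_le u v
    rw [hv] at h4
    have h5 : |‖u‖ - 1| ≤ 2 * δ := h4.trans h1
    have h6 : ‖u‖ ^ 2 - 1 = (‖u‖ - 1) * (‖u‖ + 1) := by ring
    have h7 : ‖u‖ + 1 ≤ 4 := by linarith [(abs_le.1 h5).2]
    -- The shell width is `2δ · 4`: the cube stays within `2δ` of `v`, and `δ ≤ 1` gives `‖u‖ + 1 ≤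
    -- 4`.
    change |‖u‖ ^ 2 - 1| ≤ 8 * δ
    rw [h6, abs_mul, abs_of_nonneg (by positivity : 0 ≤ ‖u‖ + 1)]
    nlinarith [norm_nonneg u]
  · set χ : R3 × R3 → ℝ≥0∞ :=
      {p : R3 × R3 | |inner ℝ p.2 p.1| ≤ 2 * δ * ‖p.2‖}.indicator 1 with hχ
    have hχm : Measurable χ := measurable_one.indicator (measurableSet_slab δ)
    have hmeas : AEMeasurable (fun p : R3 × R3 => ‖h p.2‖ₑ ^ 2 * χ p)
        ((volume.restrict A).prod volume) :=
      ((hh.aestronglyMeasurable.comp_snd (μ := volume.restrict A)).enorm.pow_const 2).mul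
        hχm.aemeasurable
    calc ∫⁻ x, ENNReal.ofReal (2 / δ) ^ 3 * ∫⁻ u in A, Φ u x
        = ENNReal.ofReal (2 / δ) ^ 3 * ∫⁻ u in A, ∫⁻ x, Φ u x := by
          rw [lintegral_const_mul' _ _ (ENNReal.pow_ne_top ENNReal.ofReal_ne_top),
            lintegral_lintegral_swap hΦm.aemeasurable]
      _ ≤ ENNReal.ofReal (2 / δ) ^ 3 * (ENNReal.ofReal (8 * b ^ 2) *
            (ENNReal.ofReal (64 * Real.pi * δ ^ 2) * ∫⁻ ζ, ‖h ζ‖ₑ ^ 2)) := by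
          refine mul_le_mul_right ((lintegral_mono fun u =>
            lintegral_sum_enorm_fourierInv_dirSymbol_le hδ hs hs' hh hh2 hmc hB hm0 hb u).trans
            ?_) _
          rw [lintegral_const_mul' _ _ ENNReal.ofReal_ne_top]
          refine mul_le_mul_right ?_ _
          -- Integrating in `u` first, at fixed `ζ`, gains the factor `δ²` against the Sobolev loss
          -- `δ⁻³`.
          rw [lintegral_lintegral_swap hmeas, ← lintegral_const_mul' _ _ ENNReal.ofReal_ne_top]
          refine lintegral_mono fun ζ => ?_
          rw [lintegral_const_mul' _ _ (by finiteness)]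
          by_cases hz : h ζ = 0
          · simp [hz]
          rw [mul_comm]
          exact mul_le_mul_left (lintegral_shell_slab_le (ne_zero_of_slab hs' hz) hδ) _
      _ = _ := by
          rw [← ENNReal.ofReal_pow (by positivity), ← mul_assoc, ← mul_assoc,
            ← ENNReal.ofReal_mul (by positivity), ← ENNReal.ofReal_mul (by positivity)]
          congr 2
          field_simp
          ring

/-- The number of `cρ`-separated unit vectors in a `ρ`-neighbourhood of a great circle. -/
theorem card_filter_slab_le {S : Finset R3} {c ρ : ℝ} (hc : 0 < c) (hρ : 0 < ρ) (hρ1 : ρ ≤ 1)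
    (hδρ : δ ≤ ρ) (hS : ∀ v ∈ S, ‖v‖ = 1)
    (hsep : ∀ v ∈ S, ∀ w ∈ S, v ≠ w → c * ρ ≤ ‖v - w‖) {ζ : R3} (hζ : ζ ≠ 0) :
    ((S.filter fun v => |inner ℝ ζ v| ≤ 2 * δ * ‖ζ‖).card : ℝ) ≤
      12 * (2 + c / 2) ^ 2 / c ^ 2 / ρ := by
  set T := S.filter fun v => |inner ℝ ζ v| ≤ 2 * δ * ‖ζ‖ with hT
  set r := c * ρ / 2 with hr
  have hr0 : 0 < r := by positivity
  have hsub : (⋃ v ∈ T, Metric.ball v r) ⊆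
      equatorialBand ζ (r * (2 + c / 2)) ((2 + c / 2) * ρ) := by
    refine Set.iUnion₂_subset fun v hv u hu => ?_
    obtain ⟨hvS, hvζ⟩ := Finset.mem_filter.1 hv
    rw [mem_ball_iff_norm] at hu
    have h4 := abs_norm_sub_norm_le u v
    rw [hS v hvS] at h4
    have h5 : |‖u‖ - 1| ≤ r := h4.trans hu.le
    refine ⟨?_, ?_⟩
    · have h6 : ‖u‖ ^ 2 - 1 = (‖u‖ - 1) * (‖u‖ + 1) := by ring
      have h7 : ‖u‖ + 1 ≤ 2 + c / 2 := by
        have : r ≤ c / 2 := by rw [hr]; nlinarith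
        linarith [(abs_le.1 h5).2]
      rw [h6, abs_mul, abs_of_nonneg (by positivity : 0 ≤ ‖u‖ + 1)]
      exact mul_le_mul h5 h7 (by positivity) hr0.le
    · have h8 : inner ℝ ζ u = inner ℝ ζ v + inner ℝ ζ (u - v) := by
        rw [← inner_add_right]; congr 1; abel
      have h9 := abs_real_inner_le_norm ζ (u - v)
      rw [h8]
      refine (abs_add_le _ _).trans ?_
      have h10 : ‖ζ‖ * ‖u - v‖ ≤ ‖ζ‖ * r := mul_le_mul_of_nonneg_left hu.le (norm_nonneg _)
      have h11 : 2 * δ * ‖ζ‖ ≤ 2 * ρ * ‖ζ‖ := by gcongr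
      calc _ ≤ 2 * ρ * ‖ζ‖ + ‖ζ‖ * r := by linarith
        _ = (2 + c / 2) * ρ * ‖ζ‖ := by rw [hr]; ring
  have hdisj : (T : Set R3).PairwiseDisjoint fun v => Metric.ball v r := by
    intro v hv w hw hvw
    refine Metric.ball_disjoint_ball ?_
    rw [dist_eq_norm]
    have := hsep v (Finset.mem_filter.1 hv).1 w (Finset.mem_filter.1 hw).1 hvw
    rw [hr]
    linarith
  have hvol := (measure_mono hsub).trans (volume_equatorialBand_le hζ (by positivity))
  rw [measure_biUnion_finset hdisj fun v _ => measurableSet_ball] at hvol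
  simp only [EuclideanSpace.volume_ball_fin_three, Finset.sum_const, nsmul_eq_mul] at hvol
  have hpos : (0 : ℝ) < c ^ 2 * ρ := by positivity
  have hreal : (T.card : ℝ) * (r ^ 3 * Real.pi * 4 / 3) ≤
      4 * Real.pi * ((2 + c / 2) * ρ) * (r * (2 + c / 2)) := by
    rw [← ENNReal.ofReal_le_ofReal_iff (by positivity)]
    refine le_trans (le_of_eq ?_) hvol
    rw [ENNReal.ofReal_mul (by positivity), ENNReal.ofReal_natCast]
    congr 1
    rw [← ENNReal.ofReal_pow hr0.le, ← ENNReal.ofReal_mul (by positivity)]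
    congr 1
    ring
  -- The bound on the count is the band volume divided by the volume of one ball of radius `r =
  -- cρ/2`.
  have h12 : 4 * Real.pi * ((2 + c / 2) * ρ) * (r * (2 + c / 2)) =
      (12 * (2 + c / 2) ^ 2 / c ^ 2 / ρ) * (r ^ 3 * Real.pi * 4 / 3) := by
    rw [hr]
    field_simp
    ring
  rw [h12] at hreal
  exact le_of_mul_le_mul_right hreal (by positivity)

/-- At frequencies comparable to `δ⁻¹` the maximal function over a `cρ`-separated set of
directions, `δ ≤ ρ`, is controlled by the square function. -/
theorem exists_majorant_separated {S : Finset R3} {c ρ : ℝ} (hc : 0 < c) (hρ : 0 < ρ)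
    (hρ1 : ρ ≤ 1) (hδρ : δ ≤ ρ) (hS : ∀ v ∈ S, ‖v‖ = 1)
    (hsep : ∀ v ∈ S, ∀ w ∈ S, v ≠ w → c * ρ ≤ ‖v - w‖)
    (hδ : 0 < δ) (hs : ∀ ζ, h ζ ≠ 0 → ‖ζ‖ ≤ δ⁻¹)
    (hs' : ∀ ζ, h ζ ≠ 0 → (2 * Real.pi)⁻¹ ≤ 2 * δ * ‖ζ‖)
    (hh : Integrable h) (hh2 : MemLp h 2 volume) (hmc : ∀ n, Continuous (m n))
    (hB : ∀ n s, ‖m n s‖ ≤ B n) (hm0 : ∀ n s, m n s ≠ 0 → |s| ≤ (2 * Real.pi)⁻¹)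
    (hb : ∀ n ≤ 3, B n ≤ b) :
    ∃ D : R3 → ℝ≥0∞,
      (∀ v ∈ S, ∀ x, ‖𝓕⁻ (dirSymbol h m δ 0 0 0 v) x‖ₑ ^ 2 ≤ D x) ∧
      ∫⁻ x, D x ≤ ENNReal.ofReal (b ^ 2 * (12 * (2 + c / 2) ^ 2 / c ^ 2 / ρ)) *
        ∫⁻ ζ, ‖h ζ‖ₑ ^ 2 := by
  refine ⟨fun x => ∑ v ∈ S, ‖𝓕⁻ (dirSymbol h m δ 0 0 0 v) x‖ₑ ^ 2, fun v hv x =>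
    Finset.single_le_sum (f := fun v => ‖𝓕⁻ (dirSymbol h m δ 0 0 0 v) x‖ₑ ^ 2)
      (fun _ _ => zero_le) hv, ?_⟩
  rw [lintegral_finsetSum _ fun v _ => (continuous_fourierInv
    (integrable_dirSymbol hδ hs hh hmc hB 0 0 0 v)).measurable.enorm.pow_const 2]
  have h1 : ∀ v ∈ S, ∫⁻ x, ‖𝓕⁻ (dirSymbol h m δ 0 0 0 v) x‖ₑ ^ 2 =
      ∫⁻ ζ, ‖dirSymbol h m δ 0 0 0 v ζ‖ₑ ^ 2 := fun v _ =>
    lintegral_enorm_fourierInv_sq (integrable_dirSymbol hδ hs hh hmc hB 0 0 0 v)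
      (memLp_dirSymbol hδ hs hh2 hmc hB 0 0 0 v)
  rw [Finset.sum_congr rfl h1, ← lintegral_finsetSum' _ fun v _ =>
    (aestronglyMeasurable_dirSymbol hh.aestronglyMeasurable hmc 0 0 0 v).enorm.pow_const 2,
    ← lintegral_const_mul' _ _ ENNReal.ofReal_ne_top]
  refine lintegral_mono fun ζ => ?_
  by_cases hz : h ζ = 0
  · simp [dirSymbol, hz]
  have hζ0 : ζ ≠ 0 := ne_zero_of_slab hs' hz
  refine (Finset.sum_le_sum fun v _ => enorm_dirSymbol_sq_le (i := 0) (j := 0) (l := 0) hδ hs hs'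
    hB hm0 (hb 0 (by norm_num)) v ζ).trans ?_
  rw [← Finset.mul_sum, ← Finset.mul_sum, ENNReal.ofReal_mul (by positivity), mul_assoc,
    mul_comm (‖h ζ‖ₑ ^ 2)]
  refine mul_le_mul_right (mul_le_mul_left ?_ _) _
  have h2 := card_filter_slab_le hc hρ hρ1 hδρ hS hsep hζ0
  -- At fixed `ζ` the overlap of the slabs is the number of directions near the great circle
  -- orthogonal to `ζ`.
  have h3 : ∑ v ∈ S, {p : R3 × R3 | |inner ℝ p.2 p.1| ≤ 2 * δ * ‖p.2‖}.indicator
      (1 : R3 × R3 → ℝ≥0∞) (v, ζ) =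
      ((S.filter fun v => |inner ℝ ζ v| ≤ 2 * δ * ‖ζ‖).card : ℝ≥0∞) := by
    rw [Finset.card_filter]
    push_cast
    refine Finset.sum_congr rfl fun v _ => ?_
    rw [Set.indicator_apply]
    rfl
  rw [h3, ← ENNReal.ofReal_natCast]
  exact ENNReal.ofReal_le_ofReal h2

end Majorant

/-! ### Directional averages as Fourier multipliers. -/

section Average

/-- The inverse Fourier transform of a real Schwartz function on the line. -/
noncomputable def lineSymbol (ψ : SchwartzMap ℝ ℝ) : SchwartzMap ℝ ℂ :=
  𝓕⁻ (ψ.postcompCLM Complex.ofRealCLM)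

theorem lineSymbol_apply (ψ : SchwartzMap ℝ ℝ) (s : ℝ) :
    lineSymbol ψ s = ∫ t : ℝ, (Real.fourierChar (t * s) : ℂ) * (ψ t : ℂ) := by
  rw [lineSymbol, SchwartzMap.fourierInv_coe, Real.fourierInv_eq]
  refine integral_congr_ae (Filter.Eventually.of_forall fun t => ?_)
  simp [Circle.smul_def, mul_comm]

theorem abs_le_of_lineSymbol_ne_zero {ψ : SchwartzMap ℝ ℝ}
    (hψ : Function.support (angularFourier ψ) ⊆ Set.Icc (-1 : ℝ) 1) {s : ℝ}
    (hs : lineSymbol ψ s ≠ 0) : |s| ≤ (2 * Real.pi)⁻¹ := by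
  -- The inverse transform reverses the sign and the `2π` convention rescales; the interval `[-1,
  -- 1]` is symmetric, so only the rescaling matters.
  have h1 : angularFourier ψ (-(2 * Real.pi * s)) = lineSymbol ψ s := by
    rw [lineSymbol_apply, angularFourier]
    refine integral_congr_ae (Filter.Eventually.of_forall fun t => ?_)
    simp only [Real.fourierChar_apply]
    congr 2
    push_cast
    ring
  have h2 := hψ (show angularFourier ψ (-(2 * Real.pi * s)) ≠ 0 by rwa [h1])
  have h3 : |2 * Real.pi * s| ≤ 1 := by
    rw [← abs_neg]
    exact abs_le.2 h2
  have hp : (0 : ℝ) < 2 * Real.pi := by positivity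
  rw [abs_mul, abs_of_pos hp] at h3
  rw [inv_eq_one_div, le_div_iff₀ hp]
  linarith

theorem hasDerivAt_iteratedDeriv_schwartz (f : SchwartzMap ℝ ℂ) (n : ℕ) (s : ℝ) :
    HasDerivAt (iteratedDeriv n f) (iteratedDeriv (n + 1) f s) s := by
  rw [iteratedDeriv_succ]
  exact ((f.smooth (n + 1)).differentiable_iteratedDeriv n (by exact_mod_cast n.lt_succ_self)
    s).hasDerivAt

theorem exists_bound_iteratedDeriv_schwartz (f : SchwartzMap ℝ ℂ) :
    ∃ B : ℕ → ℝ, ∀ n s, ‖iteratedDeriv n f s‖ ≤ B n := by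
  have h : ∀ n, ∃ C, ∀ s, ‖iteratedDeriv n f s‖ ≤ C := by
    intro n
    obtain ⟨C, hC⟩ := f.decay 0 n
    refine ⟨C, fun s => ?_⟩
    simpa [norm_iteratedFDeriv_eq_norm_iteratedDeriv] using hC.2 s
  choose B hB using h
  exact ⟨B, hB⟩

theorem abs_le_of_iteratedDeriv_ne_zero {f : ℝ → ℂ} {R : ℝ} (hf : ∀ s, f s ≠ 0 → |s| ≤ R)
    (n : ℕ) (s : ℝ) (hs : iteratedDeriv n f s ≠ 0) : |s| ≤ R := by
  have hsub : ∀ n, Function.support (iteratedDeriv n f) ⊆ {s : ℝ | |s| ≤ R} := by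
    have hcl : IsClosed {s : ℝ | |s| ≤ R} := isClosed_le (by fun_prop) (by fun_prop)
    intro n
    induction n with
    | zero => simpa [iteratedDeriv_zero] using fun s hs => hf s hs
    | succ n ih =>
      rw [iteratedDeriv_succ]
      exact (support_deriv_subset).trans (hcl.closure_subset_iff.2 ih)
  exact hsub n hs

/-- Averaging an inverse Fourier integral in the direction `v` multiplies its symbol. -/
theorem directionalAverage_fourierInv (ψ : SchwartzMap ℝ ℝ) {h : R3 → ℂ} (hh : Integrable h)
    (v x : R3) :
    directionalAverage ψ v (𝓕⁻ h) x =
      𝓕⁻ (fun ζ => h ζ * lineSymbol ψ (inner ℝ ζ v)) x := by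
  -- Characters are unimodular, so Fubini only needs `ψ ⊗ h` to be integrable.
  have hint : Integrable (fun p : ℝ × R3 =>
      (Real.fourierChar (inner ℝ p.2 (x + p.1 • v)) : ℂ) * ((ψ p.1 : ℂ) * h p.2))
      ((volume : Measure ℝ).prod volume) := by
    have h1 : Integrable (fun p : ℝ × R3 => (ψ p.1 : ℂ) * h p.2)
        ((volume : Measure ℝ).prod volume) := (ψ.integrable.ofReal).mul_prod hh
    have hc : Continuous fun p : ℝ × R3 =>
        (Real.fourierChar (inner ℝ p.2 (x + p.1 • v)) : ℂ) := by
      have := Real.continuous_fourierChar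
      fun_prop
    exact h1.bdd_mul (c := 1) hc.aestronglyMeasurable
      (Filter.Eventually.of_forall fun p => (Circle.norm_coe _).le)
  calc directionalAverage ψ v (𝓕⁻ h) x
      = ∫ t : ℝ, ∫ ζ : R3,
          (Real.fourierChar (inner ℝ ζ (x + t • v)) : ℂ) * ((ψ t : ℂ) * h ζ) := by
        refine integral_congr_ae (Filter.Eventually.of_forall fun t => ?_)
        simp only [Real.fourierInv_eq, Circle.smul_def, smul_eq_mul]
        rw [← integral_mul_const]
        refine integral_congr_ae (Filter.Eventually.of_forall fun ζ => ?_)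
        ring
    _ = ∫ ζ : R3, ∫ t : ℝ,
          (Real.fourierChar (inner ℝ ζ (x + t • v)) : ℂ) * ((ψ t : ℂ) * h ζ) :=
        integral_integral_swap hint
    _ = _ := by
        rw [Real.fourierInv_eq]
        refine integral_congr_ae (Filter.Eventually.of_forall fun ζ => ?_)
        simp only [Circle.smul_def, smul_eq_mul, lineSymbol_apply]
        rw [← mul_assoc, ← integral_const_mul]
        refine integral_congr_ae (Filter.Eventually.of_forall fun t => ?_)
        simp only [inner_add_right, inner_smul_right, AddChar.map_add_eq_mul, Circle.coe_mul]
        ring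

/-- Almost every line in a given direction meets a null set in a null set. -/
theorem ae_ae_line {P : R3 → Prop} (hP : ∀ᵐ x, P x) (v : R3) :
    ∀ᵐ x : R3, ∀ᵐ t : ℝ, P (x + t • v) := by
  obtain ⟨Z, hZ, hZm, hZ0⟩ := exists_measurable_superset_of_null (ae_iff.1 hP)
  have h1 : ∀ᵐ x : R3, ∀ᵐ t : ℝ, x + t • v ∉ Z := by
    have hm : MeasurableSet {p : ℝ × R3 | p.2 + p.1 • v ∉ Z} :=
      hZm.compl.preimage (by fun_prop : Measurable fun p : ℝ × R3 => p.2 + p.1 • v)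
    -- For each fixed `t` the exceptional `x` form a translate of a null set; Fubini exchanges the
    -- two quantifiers.
    refine (Measure.ae_ae_comm hm).1 (Filter.Eventually.of_forall fun t => ?_)
    exact (measurePreserving_add_right volume (t • v)).quasiMeasurePreserving.ae
      (measure_eq_zero_iff_ae_notMem.1 hZ0)
  filter_upwards [h1] with x hx
  filter_upwards [hx] with t ht
  by_contra hcon
  exact ht (hZ hcon)

theorem integrable_fourierInv_line (ψ : SchwartzMap ℝ ℝ) {h : R3 → ℂ} (hh : Integrable h)
    (v x : R3) : Integrable fun t : ℝ => 𝓕⁻ h (x + t • v) * (ψ t : ℂ) := by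
  have hc := continuous_fourierInv hh
  refine (ψ.integrable.ofReal (𝕜 := ℂ)).bdd_mul (c := ∫ ζ, ‖h ζ‖)
    (Continuous.aestronglyMeasurable (by fun_prop)) (Filter.Eventually.of_forall fun t => ?_)
  exact VectorFourier.norm_fourierIntegral_le_integral_norm _ _ _ _ _

end Average

/-! ### The maximal inequality. -/

/-- The frequency support of `S_k F`, in the variable `ζ = ξ / (2π)`. -/
theorem norm_bounds_of_dilate_ne_zero (μ : DyadicCutoff) (k : ℤ) {ζ : R3}
    (hz : μ.dilate k ((2 * Real.pi) • ζ) ≠ 0) :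
    ‖ζ‖ ≤ ((2 : ℝ) ^ (-k))⁻¹ ∧ (2 * Real.pi)⁻¹ ≤ 2 * (2 : ℝ) ^ (-k) * ‖ζ‖ := by
  have h1 := μ.support_subset (show μ.toFun _ ≠ 0 from hz)
  have hδ : (0 : ℝ) < (2 : ℝ) ^ (-k) := by positivity
  have hp : (0 : ℝ) < 2 * Real.pi := by positivity
  obtain ⟨h2, h3⟩ := h1
  rw [norm_smul, norm_smul, Real.norm_of_nonneg hδ.le, Real.norm_of_nonneg hp.le] at h2 h3
  norm_num at h2 h3
  set δ := (2 : ℝ) ^ (-k) with hδd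
  have hδ' : ((2 : ℝ) ^ k)⁻¹ = δ := by rw [hδd, zpow_neg]
  rw [hδ'] at h2 h3
  constructor
  · rw [inv_eq_one_div, le_div_iff₀ hδ]
    nlinarith [Real.pi_gt_three, norm_nonneg ζ, mul_nonneg hδ.le (norm_nonneg ζ)]
  · rw [inv_eq_one_div, div_le_iff₀ hp]
    nlinarith

theorem eLpNorm_two_sq (f : R3 → ℂ) : eLpNorm f 2 volume ^ 2 = ∫⁻ x, ‖f x‖ₑ ^ 2 := by
  simpa using eLpNorm_nnreal_pow_eq_lintegral (f := f) (μ := volume) (p := 2) two_ne_zero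

theorem proposition3p1
    (ψ : SchwartzMap ℝ ℝ) (hψ_nonneg : ∀ t : ℝ, 0 ≤ ψ t)
    (hψ_supp : Function.support (angularFourier ψ) ⊆ Set.Icc (-1 : ℝ) 1)
    (c : ℝ) (hc : 0 < c) :
    ∃ C : ℝ, 0 < C ∧
      ∀ (μ : DyadicCutoff) (N : ℕ) (S : Finset R3), S.card = N →
        (∀ v ∈ S, ‖v‖ = 1) →
        (∀ v ∈ S, ∀ w ∈ S, v ≠ w → c * (N : ℝ) ^ (-(1 / 2) : ℝ) ≤ ‖v - w‖) →
        ∀ (k : ℤ), 0 ≤ k → ∀ F : Lp ℂ 2 (volume : Measure R3),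
          -- the integrals defining the averages converge almost everywhere
          (∀ v ∈ S, ∀ᵐ x : R3,
            Integrable (fun t : ℝ => freqLocalize μ k F (x + t • v) * (ψ t : ℂ))) ∧
          MemLp (directionalMax ψ S (freqLocalize μ k F)) 2 volume ∧
          eLpNorm (directionalMax ψ S (freqLocalize μ k F)) 2 volume ≤
            ENNReal.ofReal (C * (N : ℝ) ^ (1 / 4 : ℝ)) *
              eLpNorm (freqLocalize μ k F) 2 volume := by
  obtain ⟨B, hB⟩ := exists_bound_iteratedDeriv_schwartz (lineSymbol ψ)
  set m : ℕ → ℝ → ℂ := fun n => iteratedDeriv n (lineSymbol ψ) with hm_def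
  have hm : ∀ n s, HasDerivAt (m n) (m (n + 1) s) s :=
    hasDerivAt_iteratedDeriv_schwartz (lineSymbol ψ)
  have hmc : ∀ n, Continuous (m n) := fun n =>
    continuous_iff_continuousAt.2 fun s => (hm n s).continuousAt
  have hm0 : ∀ n s, m n s ≠ 0 → |s| ≤ (2 * Real.pi)⁻¹ :=
    abs_le_of_iteratedDeriv_ne_zero fun s hs => abs_le_of_lineSymbol_ne_zero hψ_supp hs
  -- One derivative in each of three coordinates: only orders up to `3` of the line symbol occur.
  obtain ⟨b, hb⟩ : ∃ b, ∀ n ≤ 3, B n ≤ b :=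
    ⟨∑ n ∈ Finset.range 4, B n, fun n hn => Finset.single_le_sum (f := B)
      (fun i _ => (norm_nonneg _).trans (hB i 0)) (Finset.mem_range.2 (by omega))⟩
  -- The constants of the two regimes, plus `1` so that `C₀ > 0` even when `b = 0`.
  set C₀ : ℝ := 4096 * Real.pi * b ^ 2 + b ^ 2 * (12 * (2 + c / 2) ^ 2 / c ^ 2) + 1 with hC₀
  have hC₀1 : 4096 * Real.pi * b ^ 2 ≤ C₀ := by
    have : 0 ≤ b ^ 2 * (12 * (2 + c / 2) ^ 2 / c ^ 2) := by positivity
    linarith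
  have hC₀2 : b ^ 2 * (12 * (2 + c / 2) ^ 2 / c ^ 2) ≤ C₀ := by
    have : 0 ≤ 4096 * Real.pi * b ^ 2 := by positivity
    linarith
  have hC₀0 : 0 < C₀ := by positivity
  refine ⟨√C₀, Real.sqrt_pos.2 hC₀0, fun μ N S hN hS hsep k hk F => ?_⟩
  set δ : ℝ := (2 : ℝ) ^ (-k) with hδ_def
  have hδ : 0 < δ := by positivity
  have hδ1 : δ ≤ 1 := zpow_le_one_of_nonpos₀ one_le_two (by omega)
  set h : R3 → ℂ := fun ζ => μ.dilate k ((2 * Real.pi) • ζ) * (𝓕 F : Lp ℂ 2 volume) ζ with hh_def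
  have hs : ∀ ζ, h ζ ≠ 0 → ‖ζ‖ ≤ δ⁻¹ := fun ζ hz =>
    (norm_bounds_of_dilate_ne_zero μ k (left_ne_zero_of_mul hz)).1
  have hs' : ∀ ζ, h ζ ≠ 0 → (2 * Real.pi)⁻¹ ≤ 2 * δ * ‖ζ‖ := fun ζ hz =>
    (norm_bounds_of_dilate_ne_zero μ k (left_ne_zero_of_mul hz)).2
  have hh2 : MemLp h 2 volume := μ.memLp_dilate_mul k (𝓕 F)
  have hh : Integrable h := by
    have hsupp : Function.support h ⊆ Metric.closedBall 0 δ⁻¹ := fun ζ hz => by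
      rw [mem_closedBall_zero_iff]
      exact hs ζ hz
    rw [← integrableOn_iff_integrable_of_support_subset hsupp]
    have : IsFiniteMeasure (volume.restrict (Metric.closedBall (0 : R3) δ⁻¹)) :=
      ⟨by rw [Measure.restrict_apply_univ]; exact measure_closedBall_lt_top⟩
    exact hh2.restrict _ |>.integrable one_le_two
  set G : R3 → ℂ := ⇑(freqLocalize μ k F) with hG
  have hGae : G =ᵐ[volume] 𝓕⁻ h := fourierInv_toLp_ae_eq hh hh2
  have hGnorm : eLpNorm G 2 volume = eLpNorm h 2 volume := eLpNorm_fourierInv_toLp hh2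
  have hsym : ∀ v : R3, (fun ζ => h ζ * lineSymbol ψ (inner ℝ ζ v)) =
      dirSymbol h m δ 0 0 0 v := fun v => by
    funext ζ
    simp [dirSymbol, hm_def]
  have hline : ∀ v, ∀ᵐ x : R3, ∀ᵐ t : ℝ, G (x + t • v) = 𝓕⁻ h (x + t • v) := fun v =>
    ae_ae_line hGae v
  obtain ⟨D, hD, hDint⟩ : ∃ D : R3 → ℝ≥0∞,
      (∀ v ∈ S, ∀ x, ‖𝓕⁻ (dirSymbol h m δ 0 0 0 v) x‖ₑ ^ 2 ≤ D x) ∧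
      ∫⁻ x, D x ≤ ENNReal.ofReal (C₀ * (N : ℝ) ^ (1 / 2 : ℝ)) * ∫⁻ ζ, ‖h ζ‖ₑ ^ 2 := by
    -- For `N = 0` the scale `N^(-1/2)` degenerates, but there are no directions and `D = 0` works.
    rcases Nat.eq_zero_or_pos N with hN0 | hN0
    · refine ⟨0, fun v hv => ?_, by simp⟩
      rw [Finset.card_eq_zero.1 (hN.trans hN0)] at hv
      exact absurd hv (Finset.notMem_empty v)
    have hN1 : (1 : ℝ) ≤ N := by exact_mod_cast hN0
    set ρ : ℝ := (N : ℝ) ^ (-(1 / 2) : ℝ) with hρ_def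
    have hρ : 0 < ρ := by positivity
    have hρ1 : ρ ≤ 1 := Real.rpow_le_one_of_one_le_of_nonpos hN1 (by norm_num)
    have hρinv : (N : ℝ) ^ (1 / 2 : ℝ) = ρ⁻¹ := by
      rw [hρ_def, Real.rpow_neg (by positivity), inv_inv]
    rw [hρinv]
    rcases le_total δ ρ with hle | hle
    · obtain ⟨D, hD, hDint⟩ := exists_majorant_separated hc hρ hρ1 hle hS hsep hδ hs hs' hh hh2
        hmc hB hm0 hb
      refine ⟨D, hD, hDint.trans (mul_le_mul_left (ENNReal.ofReal_le_ofReal ?_) _)⟩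
      rw [div_eq_mul_inv _ ρ, ← mul_assoc]
      exact mul_le_mul_of_nonneg_right hC₀2 (inv_nonneg.2 hρ.le)
    · obtain ⟨D, hD, hDint⟩ := exists_majorant_sphere hδ hδ1 hs hs' hh hh2 hm hB hm0 hb
      refine ⟨D, fun v hv => hD v (hS v hv),
        hDint.trans (mul_le_mul_left (ENNReal.ofReal_le_ofReal ?_) _)⟩
      rw [div_eq_mul_inv]
      exact mul_le_mul hC₀1 (inv_anti₀ hρ hle) (inv_nonneg.2 hδ.le) hC₀0.le
  -- The `L²` representative may be replaced by the continuous function `𝓕⁻ h` on almost every line,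
  -- simultaneously for the finitely many directions.
  have hmax : directionalMax ψ S G =ᵐ[volume] fun x =>
      ((S.sup fun v => ‖𝓕⁻ (dirSymbol h m δ 0 0 0 v) x‖₊ : ℝ≥0) : ℝ) := by
    have hall : ∀ᵐ x : R3, ∀ v ∈ S, ∀ᵐ t : ℝ, G (x + t • v) = 𝓕⁻ h (x + t • v) :=
      (ae_ball_iff S.countable_toSet).2 fun v _ => hline v
    filter_upwards [hall] with x hx
    rw [directionalMax, NNReal.coe_inj]
    refine Finset.sup_congr rfl fun v hv => ?_
    rw [← hsym, ← directionalAverage_fourierInv ψ hh]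
    congr 1
    refine integral_congr_ae ?_
    filter_upwards [hx v hv] with t ht
    rw [ht]
  have hcont : Continuous fun x =>
      ((S.sup fun v => ‖𝓕⁻ (dirSymbol h m δ 0 0 0 v) x‖₊ : ℝ≥0) : ℝ) := by
    refine NNReal.continuous_coe.comp (Continuous.finset_sup_apply fun v _ => ?_)
    exact (continuous_fourierInv (integrable_dirSymbol hδ hs hh hmc hB 0 0 0 v)).nnnorm
  have hle : eLpNorm (directionalMax ψ S G) 2 volume ≤
      ENNReal.ofReal (√C₀ * (N : ℝ) ^ (1 / 4 : ℝ)) * eLpNorm G 2 volume := by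
    rw [eLpNorm_congr_ae hmax, hGnorm]
    refine le_of_not_gt fun hlt => ?_
    refine absurd (ENNReal.pow_lt_pow_left two_ne_zero hlt) (not_lt.2 ?_)
    have e2 := eLpNorm_nnreal_pow_eq_lintegral (μ := volume) (p := 2) two_ne_zero (f := fun x =>
      ((S.sup fun v => ‖𝓕⁻ (dirSymbol h m δ 0 0 0 v) x‖₊ : ℝ≥0) : ℝ))
    simp only [NNReal.coe_ofNat, ENNReal.coe_ofNat, ENNReal.rpow_ofNat] at e2
    rw [e2, mul_pow, eLpNorm_two_sq, ← ENNReal.ofReal_pow (by positivity), mul_pow,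
      Real.sq_sqrt hC₀0.le, ← Real.rpow_natCast (_ ^ (1 / 4 : ℝ)), ← Real.rpow_mul (by positivity)]
    rw [show (1 / 4 : ℝ) * ((2 : ℕ) : ℝ) = 1 / 2 by norm_num]
    refine le_trans (lintegral_mono fun x => ?_) hDint
    refine Finset.sup_induction (p := fun a : ℝ≥0 => ‖(a : ℝ)‖ₑ ^ 2 ≤ D x) (by simp)
      (fun a ha b hb => ?_) fun v hv => by simpa using hD v hv x
    rcases le_total a b with hab | hab
    · rwa [sup_eq_right.2 hab]
    · rwa [sup_eq_left.2 hab]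
  refine ⟨fun v _ => ?_, ⟨?_, ?_⟩, hle⟩
  · filter_upwards [hline v] with x hx
    refine (integrable_fourierInv_line ψ hh v x).congr ?_
    filter_upwards [hx] with t ht
    rw [ht]
  · exact hcont.aestronglyMeasurable.congr hmax.symm
  · refine hle.trans_lt (ENNReal.mul_lt_top ENNReal.ofReal_lt_top ?_)
    exact (Lp.memLp (freqLocalize μ k F)).eLpNorm_lt_top
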